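/- Let $h:\omega\to\omega$ satisfy $1<h(n)<\omega$ for all $n<\omega$. Let $\mathbb{PT}_h$ be the $h$-perfect tree forcing: its conditions are the nonempty trees $p\subseteq\omega^{<\omega}$ (closed under initial segments) such that (1) $t(l)<h(l)$ for all $t\in p$ and $l\in\operatorname{dom}(t)$; (2) every $t\in p$ has either exactly one or exactly $h(\operatorname{length}(t))$ immediate successors in $p$; (3) every $t\in p$ has an extension $t'\supseteq t$ in $p$ with exactly $h(\operatorname{length}(t'))$ immediate successors in $p$. The order is inclusion: $q\le p$ iff $q\subseteq p$. Then $\mathbb{PT}_h$ is Cohen preserving. That is, for every $p\in\mathbb{PT}_h$ and every $\mathbb{PT}_h$-name $\dot D$ such that $p\Vdash$ "$\dot D\subseteq 2^{<\omega}$ is dense and open" (dense: every $s\in 2^{<\omega}$ has an extension in $\dot D$; open: $\dot D$ is closed under extensions in $2^{<\omega}$), there are a set $E\subseteq 2^{<\omega}$ in the ground model that is dense in $2^{<\omega}$ and a condition $q\le p$ such that $q\Vdash\check E\subseteq\dot D$. -/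

import Mathlib

universe u v

namespace CohenPres

/-! ### Names and the forcing relation

The ground model is the universe of sets of type theory (`PSet.{u}`, up to extensional equality).
A condition `q` is stronger than `p` when `q ≤ p`. -/

/-- `P`-names: a name is a set-indexed family of pairs (name, condition), hence a set of such
pairs, by well-founded recursion. -/
inductive Name (P : Type v) : Type (max (u + 1) v)
  | mk (ι : Type u) (elt : ι → Name P) (cond : ι → P) : Name P

/-- A statement of the forcing language, given by the conditions that force it. -/
abbrev FStatement (P : Type v) : Type v := P → Prop

/-- The forcing relation `p ⊩ φ`. -/
def Forces {P : Type v} (p : P) (φ : FStatement P) : Prop := φ p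

section Relation

variable {P : Type v} [Preorder P]

/-- The atomic statement `τ = σ`. A condition `p` forces it iff for every pair `(τ', s)` in `τ`,
below each `q ≤ p, s` there are densely many `r` such that `r ≤ s'` and `r ⊩ τ' = σ'` for some pair
`(σ', s')` in `σ`, and symmetrically with `τ` and `σ` exchanged. -/
def fEq : Name.{u} P → Name.{u} P → FStatement P
  | ⟨_, A, a⟩, ⟨_, B, b⟩ => fun p =>
    (∀ i, ∀ q, q ≤ p → q ≤ a i → ∃ r, r ≤ q ∧ ∃ j, r ≤ b j ∧ fEq (A i) (B j) r) ∧
    (∀ j, ∀ q, q ≤ p → q ≤ b j → ∃ r, r ≤ q ∧ ∃ i, r ≤ a i ∧ fEq (A i) (B j) r)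

/-- The atomic statement `τ ∈ σ`. A condition `p` forces it iff there are densely many `r` below `p`
such that `r ≤ s` and `r ⊩ τ = σ'` for some pair `(σ', s)` in `σ`. -/
def fMem (τ : Name.{u} P) : Name.{u} P → FStatement P
  | ⟨_, B, b⟩ => fun p => ∀ q, q ≤ p → ∃ r, r ≤ q ∧ ∃ j, r ≤ b j ∧ fEq τ (B j) r

/-- Conjunction. -/
def fAnd (φ ψ : FStatement P) : FStatement P := fun p => Forces p φ ∧ Forces p ψ

/-- Implication: `p ⊩ φ → ψ` iff every `q ≤ p` that forces `φ` forces `ψ`. -/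
def fImp (φ ψ : FStatement P) : FStatement P := fun p => ∀ q, q ≤ p → Forces q φ → Forces q ψ

/-- Universal quantification over all names. -/
def fAll (φ : Name.{u} P → FStatement P) : FStatement P := fun p => ∀ τ, Forces p (φ τ)

/-- Existential quantification: `p ⊩ ∃ x, φ x` iff there are densely many `r` below `p` such that
`r ⊩ φ τ` for some name `τ`. -/
def fEx (φ : Name.{u} P → FStatement P) : FStatement P :=
  fun p => ∀ q, q ≤ p → ∃ r, r ≤ q ∧ ∃ τ, Forces r (φ τ)

/-- `τ ⊆ σ`, that is, `∀ x, x ∈ τ → x ∈ σ`. -/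
def fSubset (τ σ : Name.{u} P) : FStatement P := fAll fun x => fImp (fMem x τ) (fMem x σ)

/-- "`D ⊆ T` is dense and open", where the elements of `T` are ordered by end-extension `s ⊆ t`:
`D ⊆ T`, every `s ∈ T` has an extension `t ∈ D`, and every extension in `T` of an element of `D` is
in `D`. -/
def fDenseOpen (T D : Name.{u} P) : FStatement P :=
  fAnd (fSubset D T)
    (fAnd (fAll fun s => fImp (fMem s T) (fEx fun t => fAnd (fMem t D) (fSubset s t)))
      (fAll fun s => fImp (fMem s D)
        (fAll fun t => fImp (fMem t T) (fImp (fSubset s t) (fMem t D)))))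

/-- The canonical (check) name of a ground-model set. -/
def check [OrderTop P] : PSet.{u} → Name.{u} P
  | ⟨α, A⟩ => ⟨α, fun a => check (A a), fun _ => ⊤⟩

end Relation

/-! ### Finite binary sequences -/

/-- The Kuratowski ordered pair `{{x}, {x, y}}`. -/
def kpair (x y : PSet.{u}) : PSet.{u} := {{x}, {x, y}}

/-- A finite binary sequence as a set: the function `{(i, s i) | i < length s}`, where natural
numbers are von Neumann numerals. So `s` is an initial segment of `t` iff `code s ⊆ code t`. -/
def code (s : List Bool) : PSet.{u} :=
  ⟨ULift.{u} (Fin s.length), fun i =>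
    kpair (PSet.ofNat i.down.val) (PSet.ofNat (s.get i.down).toNat)⟩

/-- A set of finite binary sequences, as a set of the ground model. -/
def codeSet (E : Set (List Bool)) : PSet.{u} := ⟨ULift.{u} E, fun s => code s.down.val⟩

/-- `E` is dense in `2^{<ω}`: every finite binary sequence has an extension in `E`. -/
def DenseSeqs (E : Set (List Bool)) : Prop := ∀ s : List Bool, ∃ t ∈ E, s <+: t

/-- `P` is Cohen preserving: whenever `p` forces `D` to be a dense open subset of `2^{<ω}`, there
are a dense set `E ⊆ 2^{<ω}` in the ground model and `q ≤ p` with `q ⊩ Ě ⊆ D`. (The maximum of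
universe levels makes the conditions themselves elements of ground-model sets.) -/
def CohenPreserving (P : Type v) [Preorder P] [OrderTop P] : Prop :=
  ∀ (p : P) (D : Name.{max u v} P),
    Forces p (fDenseOpen (check (codeSet Set.univ)) D) →
      ∃ E : Set (List Bool), DenseSeqs E ∧ ∃ q : P, q ≤ p ∧ Forces q (fSubset (check (codeSet E)) D)

/-! ### The `h`-perfect tree forcing -/

/-- The set of (last entries of) immediate successors of `t` in `T`. -/
def succs (T : Set (List ℕ)) (t : List ℕ) : Set ℕ := {n | t ++ [n] ∈ T}

/-- The `h`-perfect trees: nonempty trees `T` of finite sequences of natural numbers with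
`t(l) < h(l)` for all `t ∈ T` and `l ∈ dom t`, such that every node has one or `h(length t)` many
immediate successors, and every node `t` has an extension `t'` in `T` that has `h(length t')` many
immediate successors. -/
@[ext]
structure PT (h : ℕ → ℕ) : Type where
  tree : Set (List ℕ)
  isTree : tree ∈ Descriptive.tree ℕ
  nonempty : tree.Nonempty
  bounded : ∀ t ∈ tree, ∀ (l : ℕ) (hl : l < t.length), t[l] < h l
  one_or_all : ∀ t ∈ tree, (succs tree t).ncard = 1 ∨ (succs tree t).ncard = h t.length
  splits : ∀ t ∈ tree, ∃ t' ∈ tree, t <+: t' ∧ (succs tree t').ncard = h t'.length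

/-- The order on conditions is inclusion. -/
instance (h : ℕ → ℕ) : PartialOrder (PT h) :=
  PartialOrder.lift PT.tree fun _ _ => PT.ext

/-- The set of all finite sequences bounded by `h`. -/
def fullTree (h : ℕ → ℕ) : Set (List ℕ) :=
  {t | ∀ (l : ℕ) (hl : l < t.length), t[l] < h l}

theorem succs_fullTree (h : ℕ → ℕ) (t : List ℕ) (ht : t ∈ fullTree h) :
    (succs (fullTree h) t).ncard = h t.length := by
  have : succs (fullTree h) t = (Finset.range (h t.length) : Set ℕ) := by
    ext n
    simp only [succs, fullTree, Set.mem_ofPred_eq, Finset.coe_range, Set.mem_Iio]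
    constructor
    · intro H
      simpa using H t.length (by simp)
    · intro hn l hl
      rcases Nat.lt_or_ge l t.length with h1 | h1
      · rw [List.getElem_append_left h1]
        exact ht l h1
      · have h2 : l = t.length := by
          simp at hl
          omega
        subst h2
        simpa using hn
  rw [this, Set.ncard_coe_finset, Finset.card_range]

/-- The weakest condition is the full tree. -/
instance (h : ℕ → ℕ) : OrderTop (PT h) where
  top :=
    { tree := fullTree h
      isTree := by
        intro x a hx l hl
        have := hx l (by simp; omega)
        rwa [List.getElem_append_left hl] at this
      nonempty := ⟨[], fun l hl => absurd hl (by simp)⟩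
      bounded := fun t ht => ht
      one_or_all := fun t ht => Or.inr (succs_fullTree h t ht)
      splits := fun t ht => ⟨t, ht, List.prefix_refl t, succs_fullTree h t ht⟩ }
  le_top p := fun t ht => p.bounded t ht

end CohenPres

/-!
The proof is a fusion argument. Say that `p` forces `t ∈ D`, for `t ∈ 2^{<ω}`, when
`p ⊩ code(t)ˇ ∈ D`. Forcing `t ∈ D` is inherited by stronger conditions and by extensions of `t`
(`D` is open), holds at `p` once it holds densely below `p`, and any `s` extends to some `t` that
some stronger condition forces into `D` (`D` is dense); that this `t` is a sequence of the ground
model uses that elements of a check name are decided densely and that inclusion between check names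
is absolute.

The combinatorial point is `PT.exists_agree_forall`: given a level `L` of a condition `p` and
`s ∈ 2^{<ω}`, one can shrink `p` above level `L` only, and extend `s` to one `t`, so that the new
condition forces `t ∈ D`. Level `L` is finite because `p` is bounded by `h`, so its nodes `σ` are
treated one after the other: above `σ`, the condition is replaced by a stronger one forcing a further
extension of the current `t` into `D`, and openness keeps what was achieved at the earlier nodes.

Running through all `s` while raising the levels `L` fast enough that a splitting node is kept between
any two of them, the decreasing sequence of conditions has a lower bound (`PT.exists_fusion`), and the
sequences `t` obtained on the way form the dense set `E`.
-/

namespace CohenPres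

/-! ### Atomic forcing -/

section Atomic

variable {P : Type v} [Preorder P]

theorem fEq_mono {τ σ : Name.{u} P} {p q : P} (hqp : q ≤ p) (H : fEq τ σ p) : fEq τ σ q := by
  cases τ; cases σ
  rw [fEq] at H ⊢
  exact ⟨fun i r hr => H.1 i r (hr.trans hqp), fun j r hr => H.2 j r (hr.trans hqp)⟩

theorem fMem_mono {τ σ : Name.{u} P} {p q : P} (hqp : q ≤ p) (H : fMem τ σ p) : fMem τ σ q := by
  cases σ
  exact fun r hr => H r (hr.trans hqp)

theorem fMem_of_dense {τ σ : Name.{u} P} {p : P} (H : ∀ q ≤ p, ∃ r ≤ q, fMem τ σ r) :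
    fMem τ σ p := by
  cases σ
  intro q hq
  obtain ⟨r, hr, hm⟩ := H q hq
  obtain ⟨r', hr', h'⟩ := hm r le_rfl
  exact ⟨r', hr'.trans hr, h'⟩

theorem fEq_refl (τ : Name.{u} P) (p : P) : fEq τ τ p := by
  induction τ generalizing p with
  | mk ι A a ih =>
    rw [fEq]
    exact ⟨fun i q _ hi => ⟨q, le_rfl, i, hi, ih i q⟩, fun i q _ hi => ⟨q, le_rfl, i, hi, ih i q⟩⟩

theorem fEq_trans {τ σ ρ : Name.{u} P} {p : P} (h₁ : fEq τ σ p) (h₂ : fEq σ ρ p) :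
    fEq τ ρ p := by
  induction τ generalizing σ ρ p with
  | mk ι A a ih =>
    cases σ; cases ρ
    rw [fEq] at h₁ h₂ ⊢
    constructor
    · intro i q hq hi
      obtain ⟨r, hr, j, hj, e₁⟩ := h₁.1 i q hq hi
      obtain ⟨r', hr', k, hk, e₂⟩ := h₂.1 j r (hr.trans hq) hj
      exact ⟨r', hr'.trans hr, k, hk, ih i (fEq_mono hr' e₁) e₂⟩
    · intro k q hq hk
      obtain ⟨r, hr, j, hj, e₂⟩ := h₂.2 k q hq hk
      obtain ⟨r', hr', i, hi, e₁⟩ := h₁.2 j r (hr.trans hq) hj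
      exact ⟨r', hr'.trans hr, i, hi, ih i e₁ (fEq_mono hr' e₂)⟩

theorem fEq_symm {τ σ : Name.{u} P} {p : P} (H : fEq τ σ p) : fEq σ τ p := by
  induction τ generalizing σ p with
  | mk ι A a ih =>
    cases σ
    rw [fEq] at H ⊢
    constructor
    · intro j q hq hj
      obtain ⟨r, hr, i, hi, e⟩ := H.2 j q hq hj
      exact ⟨r, hr, i, hi, ih i e⟩
    · intro i q hq hi
      obtain ⟨r, hr, j, hj, e⟩ := H.1 i q hq hi
      exact ⟨r, hr, j, hj, ih i e⟩

theorem fMem_congr_left {τ τ' σ : Name.{u} P} {p : P} (he : fEq τ τ' p) (hm : fMem τ' σ p) :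
    fMem τ σ p := by
  cases σ
  intro q hq
  obtain ⟨r, hr, j, hj, e⟩ := hm q hq
  exact ⟨r, hr, j, hj, fEq_trans (fEq_mono (hr.trans hq) he) e⟩

theorem fMem_congr_right {τ σ σ' : Name.{u} P} {p : P} (he : fEq σ σ' p) (hm : fMem τ σ p) :
    fMem τ σ' p := by
  cases σ; cases σ'
  rw [fEq] at he
  intro q hq
  obtain ⟨r, hr, j, hj, e⟩ := hm q hq
  obtain ⟨r', hr', k, hk, e'⟩ := he.1 j r (hr.trans hq) hj
  exact ⟨r', hr'.trans hr, k, hk, fEq_trans (fEq_mono hr' e) e'⟩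

theorem forces_fDenseOpen_mono {T D : Name.{u} P} {p q : P} (hqp : q ≤ p)
    (H : Forces p (fDenseOpen T D)) : Forces q (fDenseOpen T D) :=
  ⟨fun x r hr => H.1 x r (hr.trans hqp), fun x r hr => H.2.1 x r (hr.trans hqp),
    fun x r hr => H.2.2 x r (hr.trans hqp)⟩

end Atomic

/-! ### Check names -/

section Check

variable {P : Type v} [Preorder P] [OrderTop P]

theorem fMem_check_iff {τ : Name.{u} P} {x : PSet.{u}} {p : P} :
    fMem τ (check x) p ↔ ∀ q ≤ p, ∃ r ≤ q, ∃ j, fEq τ (check (x.Func j)) r := by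
  cases x
  constructor
  · intro H q hq
    obtain ⟨r, hr, j, -, e⟩ := H q hq
    exact ⟨r, hr, j, e⟩
  · intro H q hq
    obtain ⟨r, hr, j, e⟩ := H q hq
    exact ⟨r, hr, j, le_top, e⟩

theorem fMem_check_func (x : PSet.{u}) (j : x.Type) (p : P) :
    fMem (check (x.Func j)) (check x) p :=
  fMem_check_iff.2 fun q _ => ⟨q, le_rfl, j, fEq_refl _ _⟩

/-- Equality of check names is absolute. -/
theorem equiv_of_fEq_check {x y : PSet.{u}} {p : P} (H : fEq (check x) (check y) p) :
    x.Equiv y := by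
  induction x generalizing y p with
  | mk α A ih =>
    cases y
    rw [check, check, fEq] at H
    constructor
    · intro i
      obtain ⟨r, -, j, -, e⟩ := H.1 i p le_rfl le_top
      exact ⟨j, ih i e⟩
    · intro j
      obtain ⟨r, -, i, -, e⟩ := H.2 j p le_rfl le_top
      exact ⟨i, ih i e⟩

/-- Inclusion between check names is absolute. -/
theorem subset_of_fSubset_check {x y : PSet.{u}} {p : P}
    (H : fSubset (check x) (check y) p) : x ⊆ y := by
  rw [PSet.subset_iff]
  intro z hz
  obtain ⟨i, hi⟩ := hz
  obtain ⟨r, -, j, e⟩ :=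
    fMem_check_iff.1 (H (check (x.Func i)) p le_rfl (fMem_check_func x i p)) p le_rfl
  exact ⟨j, hi.trans (equiv_of_fEq_check e)⟩

end Check

/-! ### Codes of finite binary sequences -/

theorem ofNat_mem_ofNat {m n : ℕ} (hmn : m < n) : PSet.ofNat.{u} m ∈ PSet.ofNat.{u} n := by
  induction n with
  | zero => omega
  | succ n ih =>
    rw [PSet.ofNat, PSet.mem_insert_iff]
    rcases Nat.lt_succ_iff_lt_or_eq.1 hmn with h1 | rfl
    · exact Or.inr (ih h1)
    · exact Or.inl (PSet.Equiv.refl _)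

theorem ofNat_equiv_iff {m n : ℕ} : (PSet.ofNat.{u} m).Equiv (PSet.ofNat.{u} n) ↔ m = n := by
  constructor
  · intro e
    rcases lt_trichotomy m n with h1 | h1 | h1
    · exact absurd ((PSet.Mem.congr_left e).1 (ofNat_mem_ofNat h1)) (PSet.mem_irrefl _)
    · exact h1
    · exact absurd ((PSet.Mem.congr_left e).2 (ofNat_mem_ofNat h1)) (PSet.mem_irrefl _)
  · rintro rfl
    exact PSet.Equiv.refl _

theorem kpair_equiv {x y x' y' : PSet.{u}} (e : (kpair x y).Equiv (kpair x' y')) :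
    x.Equiv x' ∧ y.Equiv y' := by
  have e' : ZFSet.pair (ZFSet.mk x) (ZFSet.mk y) = ZFSet.pair (ZFSet.mk x') (ZFSet.mk y') :=
    ZFSet.sound e
  rw [ZFSet.pair_inj] at e'
  exact ⟨ZFSet.exact e'.1, ZFSet.exact e'.2⟩

theorem prefix_of_code_subset {s t : List Bool} (H : code.{u} s ⊆ code.{u} t) : s <+: t := by
  have key : ∀ (i : ℕ) (hi : i < s.length), ∃ hi' : i < t.length, t[i] = s[i] := by
    intro i hi
    obtain ⟨⟨j⟩, e⟩ := H ⟨⟨i, hi⟩⟩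
    obtain ⟨e₁, e₂⟩ := kpair_equiv e
    rw [ofNat_equiv_iff] at e₁ e₂
    obtain ⟨j, hj⟩ := j
    simp only at e₁ e₂
    subst e₁
    exact ⟨hj, by revert e₂; simp only [List.get_eq_getElem]; cases s[i] <;> cases t[i] <;> simp⟩
  rw [List.prefix_iff_getElem]
  refine ⟨?_, fun i hi => (key i hi).2.symm⟩
  by_contra hlt
  push Not at hlt
  exact absurd (key t.length hlt).1 (lt_irrefl _)

section Code

variable {P : Type v} [Preorder P] [OrderTop P]

theorem fSubset_check_code {s t : List Bool} (hst : s <+: t) (p : P) :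
    fSubset (check (code.{u} s)) (check (code.{u} t)) p := by
  intro τ q _ H
  rw [Forces, fMem_check_iff] at H ⊢
  intro r hr
  obtain ⟨r', hr', ⟨⟨i, hi⟩⟩, e⟩ := H r hr
  refine ⟨r', hr', ⟨⟨i, hi.trans_le hst.length_le⟩⟩, ?_⟩
  have : t[i]'(hi.trans_le hst.length_le) = s[i] := (hst.getElem hi).symm
  simpa [code, PSet.Func, this] using e

theorem fMem_check_code (E : Set (List Bool)) {t : List Bool} (ht : t ∈ E) (p : P) :
    fMem (check (code.{u} t)) (check (codeSet.{u} E)) p :=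
  fMem_check_func (codeSet E) ⟨t, ht⟩ p

/-- Below a condition forcing `D` to be dense open, every finite binary sequence has an extension
forced into `D` by a stronger condition. -/
theorem exists_prefix_fMem {p : P} {D : Name.{u} P}
    (H : Forces p (fDenseOpen (check (codeSet Set.univ)) D)) (s : List Bool) :
    ∃ r ≤ p, ∃ t, s <+: t ∧ fMem (check (code.{u} t)) D r := by
  obtain ⟨hT, hd, -⟩ := H
  obtain ⟨r, hr, τ, hτ, hsub⟩ :=
    hd (check (code s)) p le_rfl (fMem_check_code _ (Set.mem_univ s) p) p le_rfl
  obtain ⟨r', hr', ⟨⟨t, _⟩⟩, e⟩ := fMem_check_iff.1 (hT τ r hr hτ) r le_rfl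
  refine ⟨r', hr'.trans hr, t, prefix_of_code_subset.{u} (subset_of_fSubset_check (p := r') ?_),
    fMem_congr_left (fEq_symm e) (fMem_mono hr' hτ)⟩
  exact fun x q hq hx => fMem_congr_right (fEq_mono hq e) (hsub x q (hq.trans hr') hx)

theorem fMem_of_prefix {p : P} {D : Name.{u} P}
    (H : Forces p (fDenseOpen (check (codeSet Set.univ)) D)) {s t : List Bool} (hst : s <+: t)
    {q : P} (hq : q ≤ p) (hs : fMem (check (code.{u} s)) D q) : fMem (check (code.{u} t)) D q :=
  H.2.2 (check (code s)) q hq hs (check (code t)) q le_rfl (fMem_check_code _ (Set.mem_univ t) q)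
    q le_rfl (fSubset_check_code hst q)

theorem forces_codeSet_subset {E : Set (List Bool)} {q : P} {D : Name.{u} P}
    (H : ∀ t ∈ E, fMem (check (code.{u} t)) D q) :
    Forces q (fSubset (check (codeSet E)) D) := by
  intro τ r hr hτ
  refine fMem_of_dense fun r₁ hr₁ => ?_
  obtain ⟨r', hr', ⟨t, ht⟩, e⟩ := fMem_check_iff.1 hτ r₁ hr₁
  exact ⟨r', hr', fMem_congr_left e (fMem_mono (hr'.trans (hr₁.trans hr)) (H t ht))⟩

end Code

/-! ### Trees: restriction, amalgamation and fusion -/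

namespace PT

variable {h : ℕ → ℕ}

theorem mem_of_prefix (p : PT h) {s t : List ℕ} (hst : s <+: t) (ht : t ∈ p.tree) :
    s ∈ p.tree :=
  Descriptive.Tree.mem_of_prefix (T := ⟨p.tree, p.isTree⟩) hst ht

theorem exists_succ (hh : ∀ n, 1 < h n) (p : PT h) {t : List ℕ} (ht : t ∈ p.tree) :
    ∃ n, t ++ [n] ∈ p.tree := by
  refine Set.nonempty_of_ncard_ne_zero (s := succs p.tree t) ?_
  have := hh t.length
  rcases p.one_or_all t ht with h1 | h1 <;> omega

theorem exists_extension (hh : ∀ n, 1 < h n) (p : PT h) {t : List ℕ} (ht : t ∈ p.tree) {L : ℕ}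
    (hL : t.length ≤ L) : ∃ t' ∈ p.tree, t <+: t' ∧ t'.length = L := by
  induction L, hL using Nat.le_induction with
  | base => exact ⟨t, ht, List.prefix_refl t, rfl⟩
  | succ L _ ih =>
    obtain ⟨t', ht', hp, hl⟩ := ih
    obtain ⟨n, hn⟩ := p.exists_succ hh ht'
    exact ⟨_, hn, hp.trans (List.prefix_append _ _), by simp [hl]⟩

theorem nil_mem (p : PT h) : [] ∈ p.tree :=
  let ⟨_, ht⟩ := p.nonempty
  p.mem_of_prefix List.nil_prefix ht

theorem exists_length_eq (hh : ∀ n, 1 < h n) (p : PT h) (L : ℕ) :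
    ∃ t ∈ p.tree, t.length = L :=
  let ⟨t, ht, _, hl⟩ := p.exists_extension hh p.nil_mem (Nat.zero_le L)
  ⟨t, ht, hl⟩

/-- The levels of a condition are finite. -/
theorem finite_level (p : PT h) (L : ℕ) : {t ∈ p.tree | t.length = L}.Finite := by
  refine Set.Finite.subset (Set.Finite.image (fun f : Fin L → ℕ => List.ofFn f)
    (Set.Finite.pi' fun i : Fin L => Set.finite_lt_nat (h i))) ?_
  rintro t ⟨ht, rfl⟩
  exact ⟨fun i => t[i], fun i => p.bounded t ht i i.2, by simp⟩

theorem mem_tree_iff {T : Set (List ℕ)} :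
    T ∈ Descriptive.tree ℕ ↔ ∀ s n, s ++ [n] ∈ T → s ∈ T :=
  ⟨fun H _ _ hs => H hs, fun H s n hs => H s n hs⟩

/-- The condition consisting of the nodes of `p` comparable with `σ`. -/
def restrict (p : PT h) (σ : List ℕ) (hσ : σ ∈ p.tree) : PT h where
  tree := {t ∈ p.tree | t <+: σ ∨ σ <+: t}
  isTree := by
    rw [mem_tree_iff]
    rintro s n ⟨hs, hc⟩
    have hp : s <+: s ++ [n] := List.prefix_append _ _
    refine ⟨p.mem_of_prefix hp hs, ?_⟩
    rcases hc with hc | hc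
    · exact Or.inl (hp.trans hc)
    · exact List.prefix_or_prefix_of_prefix hp hc
  nonempty := ⟨σ, hσ, Or.inl (List.prefix_refl σ)⟩
  bounded t ht := p.bounded t ht.1
  one_or_all := by
    rintro t ⟨ht, hc⟩
    by_cases hσt : σ <+: t
    · have : succs {t ∈ p.tree | t <+: σ ∨ σ <+: t} t = succs p.tree t := by
        ext n
        exact ⟨fun hn => hn.1, fun hn => ⟨hn, Or.inr (hσt.trans (List.prefix_append _ _))⟩⟩
      rw [this]
      exact p.one_or_all t ht
    · -- A proper initial segment of `σ` keeps only its successor along `σ`.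
      obtain ⟨u, rfl⟩ := hc.resolve_right hσt
      cases u with
      | nil => simp at hσt
      | cons a u =>
        left
        rw [Set.ncard_eq_one]
        refine ⟨a, Set.eq_singleton_iff_unique_mem.2 ⟨⟨p.mem_of_prefix ?_ hσ, Or.inl ?_⟩, ?_⟩⟩
        · simp
        · simp
        · rintro n ⟨-, hn | hn⟩
          · simpa using hn
          · simp at hn
            exact hn.1.symm
  splits := by
    have key : ∀ t ∈ p.tree, σ <+: t → ∃ t' ∈ {t ∈ p.tree | t <+: σ ∨ σ <+: t}, t <+: t' ∧
        (succs {t ∈ p.tree | t <+: σ ∨ σ <+: t} t').ncard = h t'.length := by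
      intro t ht hσt
      obtain ⟨t', ht', hp, hs⟩ := p.splits t ht
      refine ⟨t', ⟨ht', Or.inr (hσt.trans hp)⟩, hp, ?_⟩
      rw [← hs]
      congr 1
      ext n
      exact ⟨fun hn => hn.1,
        fun hn => ⟨hn, Or.inr ((hσt.trans hp).trans (List.prefix_append _ _))⟩⟩
    rintro t ⟨ht, hc | hc⟩
    · obtain ⟨t', ht', hp, hs⟩ := key σ hσ (List.prefix_refl σ)
      exact ⟨t', ht', hc.trans hp, hs⟩
    · exact key t ht hc

theorem restrict_le (p : PT h) {σ : List ℕ} (hσ : σ ∈ p.tree) : p.restrict σ hσ ≤ p :=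
  fun _ ht => ht.1

theorem mem_of_le_restrict (hh : ∀ n, 1 < h n) {p r : PT h} {σ : List ℕ} (hσ : σ ∈ p.tree)
    (hr : r ≤ p.restrict σ hσ) : σ ∈ r.tree := by
  obtain ⟨t, ht, hl⟩ := r.exists_length_eq hh σ.length
  rcases (hr ht).2 with hc | hc
  · rwa [← hc.eq_of_length hl]
  · rwa [hc.eq_of_length hl.symm]

/-- The condition obtained from `p` by replacing its part above `σ` by that of `r`. -/
def amalgam (p : PT h) (σ : List ℕ) (r : PT h) (hr : r ≤ p) (hσ : σ ∈ r.tree) : PT h where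
  tree := {t ∈ p.tree | σ <+: t → t ∈ r.tree}
  isTree := by
    rw [mem_tree_iff]
    rintro s n ⟨hs, hc⟩
    have hp : s <+: s ++ [n] := List.prefix_append _ _
    exact ⟨p.mem_of_prefix hp hs, fun hσs => r.mem_of_prefix hp (hc (hσs.trans hp))⟩
  nonempty := ⟨σ, hr hσ, fun _ => hσ⟩
  bounded t ht := p.bounded t ht.1
  one_or_all := by
    rintro t ⟨ht, hc⟩
    by_cases hσt : σ <+: t
    · convert r.one_or_all t (hc hσt) using 3 <;>
      · ext n
        exact ⟨fun hn => hn.2 (hσt.trans (List.prefix_append _ _)), fun hn => ⟨hr hn, fun _ => hn⟩⟩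
    · convert p.one_or_all t ht using 3 <;>
      · ext n
        refine ⟨fun hn => hn.1, fun hn => ⟨hn, fun hσn => ?_⟩⟩
        rcases List.prefix_concat_iff.1 hσn with e | e
        · rwa [← e]
        · exact absurd e hσt
  splits := by
    have key : ∀ t ∈ r.tree, σ <+: t → ∃ t' ∈ {t ∈ p.tree | σ <+: t → t ∈ r.tree}, t <+: t' ∧
        (succs {t ∈ p.tree | σ <+: t → t ∈ r.tree} t').ncard = h t'.length := by
      intro t ht hσt
      obtain ⟨t', ht', hp, hs⟩ := r.splits t ht
      refine ⟨t', ⟨hr ht', fun _ => ht'⟩, hp, ?_⟩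
      rw [← hs]
      congr 1
      ext n
      exact ⟨fun hn => hn.2 ((hσt.trans hp).trans (List.prefix_append _ _)),
        fun hn => ⟨hr hn, fun _ => hn⟩⟩
    rintro t ⟨ht, hc⟩
    by_cases hσt : σ <+: t
    · exact key t (hc hσt) hσt
    · obtain ⟨t', ht', hp, hs⟩ := p.splits t ht
      by_cases hσt' : σ <+: t'
      · -- The splitting node found in `p` may be lost in `r`, but then `t` lies below `σ`.
        obtain ⟨t'', ht'', hp'', hs''⟩ := key σ hσ (List.prefix_refl σ)
        exact ⟨t'', ht'',
          ((List.prefix_or_prefix_of_prefix hp hσt').resolve_right hσt).trans hp'', hs''⟩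
      · refine ⟨t', ⟨ht', fun e => absurd e hσt'⟩, hp, ?_⟩
        rw [← hs]
        congr 1
        ext n
        refine ⟨fun hn => hn.1, fun hn => ⟨hn, fun hσn => ?_⟩⟩
        rcases List.prefix_concat_iff.1 hσn with e | e
        · rwa [← e]
        · exact absurd e hσt'

/-- If the conditions `r` with `φ r t` are, with `t` ranging over the extensions of any given `s`,
dense below `p`, and `φ r` is closed under extensions, then `p` can be shrunk above level `L` only so
that a single `t` extending `s` satisfies `φ r t` for densely many `r`. -/
theorem exists_agree_forall (hh : ∀ n, 1 < h n) {φ : PT h → List Bool → Prop} {p : PT h}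
    (dense : ∀ r ≤ p, ∀ s, ∃ r' ≤ r, ∃ t, s <+: t ∧ φ r' t)
    (mono : ∀ r r' t, r' ≤ r → φ r t → φ r' t)
    (ext : ∀ r ≤ p, ∀ s t, s <+: t → φ r s → φ r t) (L : ℕ) (s : List Bool) :
    ∃ p' ≤ p, (∀ t ∈ p.tree, t.length ≤ L → t ∈ p'.tree) ∧
      ∃ t, s <+: t ∧ ∀ r ≤ p', ∃ r' ≤ r, φ r' t := by
  -- Treat the nodes of level `L` one after the other.
  have key : ∀ F : Set (List ℕ), F.Finite → F ⊆ {t ∈ p.tree | t.length = L} →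
      ∃ p' ≤ p, (∀ t ∈ p.tree, t.length ≤ L → t ∈ p'.tree) ∧
        ∃ t, s <+: t ∧ ∀ σ ∈ F, ∀ r ≤ p', σ ∈ r.tree → ∃ r' ≤ r, φ r' t := by
    intro F hF
    induction F, hF using Set.Finite.induction_on with
    | empty => exact fun _ => ⟨p, le_rfl, fun t ht _ => ht, s, List.prefix_refl s, by simp⟩
    | @insert σ F _ _ ih =>
      intro hsub
      obtain ⟨p₁, hp₁, hag, t, hst, ht⟩ := ih ((Set.subset_insert σ F).trans hsub)
      obtain ⟨hσp, hσL⟩ := hsub (Set.mem_insert σ F)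
      have hσ : σ ∈ p₁.tree := hag σ hσp hσL.le
      obtain ⟨r₀, hr₀, t', htt', hφ⟩ :=
        dense (p₁.restrict σ hσ) ((p₁.restrict_le hσ).trans hp₁) t
      have hσr₀ : σ ∈ r₀.tree := mem_of_le_restrict hh hσ hr₀
      have hr₀p₁ : r₀ ≤ p₁ := hr₀.trans (p₁.restrict_le hσ)
      have hle : p₁.amalgam σ r₀ hr₀p₁ hσr₀ ≤ p₁ := fun _ hu => hu.1
      refine ⟨p₁.amalgam σ r₀ hr₀p₁ hσr₀, hle.trans hp₁, fun u hu hul => ⟨hag u hu hul, ?_⟩,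
        t', hst.trans htt', ?_⟩
      · intro hσu
        rwa [← hσu.eq_of_length_le (by omega)]
      · intro τ hτ r hr hτr
        rcases Set.mem_insert_iff.1 hτ with rfl | hτF
        · refine ⟨r.restrict τ hτr, r.restrict_le hτr, mono r₀ _ _ ?_ hφ⟩
          rintro u ⟨hu, hc | hc⟩
          · exact r₀.mem_of_prefix hc hσr₀
          · exact (hr hu).2 hc
        · obtain ⟨r', hr', hφ'⟩ := ht τ hτF r (hr.trans hle) hτr
          exact ⟨r', hr', ext r' (hr'.trans (hr.trans (hle.trans hp₁))) _ _ htt' hφ'⟩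
  obtain ⟨p', hp', hag, t, hst, ht⟩ := key _ (p.finite_level L) subset_rfl
  refine ⟨p', hp', hag, t, hst, fun r hr => ?_⟩
  obtain ⟨σ, hσ, hl⟩ := r.exists_length_eq hh L
  exact ht σ ⟨hp' (hr hσ), hl⟩ r hr hσ

/-- Every node of level `L` splits again before some later level. -/
theorem exists_level_splits (p : PT h) (L : ℕ) :
    ∃ L' > L, ∀ t ∈ p.tree, t.length = L →
      ∃ t' ∈ p.tree, t <+: t' ∧ t'.length < L' ∧ (succs p.tree t').ncard = h t'.length := by
  choose! f hf using p.splits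
  obtain ⟨M, hM⟩ := ((p.finite_level L).image fun t => (f t).length).bddAbove
  refine ⟨max L M + 1, by omega, fun t ht hl => ⟨f t, (hf t ht).1, (hf t ht).2.1, ?_, (hf t ht).2.2⟩⟩
  have : (f t).length ≤ M := hM ⟨t, ⟨ht, hl⟩, rfl⟩
  omega

/-- A decreasing sequence of conditions has a lower bound if the `n`-th and the next condition agree
up to a level `L n`, and the nodes of level `L n` split before level `L (n + 1)`. -/
theorem exists_fusion (hh : ∀ n, 1 < h n) (p : ℕ → PT h) (L : ℕ → ℕ)
    (anti : ∀ n, p (n + 1) ≤ p n) (hL : ∀ n, L n < L (n + 1))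
    (agree : ∀ n, ∀ t ∈ (p n).tree, t.length ≤ L n → t ∈ (p (n + 1)).tree)
    (split : ∀ n, ∀ t ∈ (p (n + 1)).tree, t.length = L n → ∃ t' ∈ (p (n + 1)).tree, t <+: t' ∧
      t'.length < L (n + 1) ∧ (succs (p (n + 1)).tree t').ncard = h t'.length) :
    ∃ q, ∀ n, q ≤ p n := by
  have hanti : Antitone p := antitone_nat_of_succ_le anti
  have hmono : StrictMono L := strictMono_nat_of_lt_succ hL
  have mem_all : ∀ {n t}, t ∈ (p n).tree → t.length ≤ L n → ∀ m, t ∈ (p m).tree := by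
    intro n t ht hl m
    rcases le_total m n with hmn | hmn
    · exact hanti hmn ht
    · induction m, hmn using Nat.le_induction with
      | base => exact ht
      | succ m hnm ih => exact agree m t ih (hl.trans (hmono.monotone hnm))
  have succs_eq : ∀ {n t}, t.length < L n →
      succs {t | ∀ m, t ∈ (p m).tree} t = succs (p n).tree t := by
    intro n t hl
    ext k
    exact ⟨fun hk => hk n, fun hk => mem_all hk (by simpa using hl)⟩
  refine ⟨⟨{t | ∀ m, t ∈ (p m).tree}, ?_, ⟨[], fun m => (p m).nil_mem⟩,
    fun t ht => (p 0).bounded t (ht 0), ?_, ?_⟩, fun n t ht => ht n⟩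
  · rw [mem_tree_iff]
    exact fun s n hs m => (p m).mem_of_prefix (List.prefix_append _ _) (hs m)
  · intro t ht
    rw [succs_eq (Nat.lt_of_lt_of_le (Nat.lt_succ_self _) (hmono.id_le (t.length + 1)))]
    exact (p _).one_or_all t (ht _)
  · intro t ht
    obtain ⟨u, hu, htu, hul⟩ :=
      (p (t.length + 1)).exists_extension hh (ht _) (hmono.id_le t.length)
    obtain ⟨t', ht', hut', hl', hs⟩ := split t.length u hu hul
    refine ⟨t', mem_all ht' hl'.le, htu.trans hut', ?_⟩
    rw [succs_eq hl', hs]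

/-- If `φ r t` is dense in `r` and `t` below `p₀`, inherited by stronger conditions and by extensions
of `t`, and local in `r`, then some `q ≤ p₀` satisfies `φ q t` for a dense set of `t`. -/
theorem exists_denseSeqs (hh : ∀ n, 1 < h n) {φ : PT h → List Bool → Prop} {p₀ : PT h}
    (dense : ∀ r ≤ p₀, ∀ s, ∃ r' ≤ r, ∃ t, s <+: t ∧ φ r' t)
    (mono : ∀ r r' t, r' ≤ r → φ r t → φ r' t)
    (ext : ∀ r ≤ p₀, ∀ s t, s <+: t → φ r s → φ r t)
    (loc : ∀ r t, (∀ r' ≤ r, ∃ r'' ≤ r', φ r'' t) → φ r t) :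
    ∃ E : Set (List Bool), DenseSeqs E ∧ ∃ q ≤ p₀, ∀ t ∈ E, φ q t := by
  have step : ∀ (s : List Bool) (x : {x : PT h × ℕ // x.1 ≤ p₀}),
      ∃ y : {x : PT h × ℕ // x.1 ≤ p₀}, y.1.1 ≤ x.1.1 ∧ x.1.2 < y.1.2 ∧
        (∀ t ∈ x.1.1.tree, t.length ≤ x.1.2 → t ∈ y.1.1.tree) ∧
        (∀ t ∈ y.1.1.tree, t.length = x.1.2 → ∃ t' ∈ y.1.1.tree, t <+: t' ∧
          t'.length < y.1.2 ∧ (succs y.1.1.tree t').ncard = h t'.length) ∧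
        ∃ t, s <+: t ∧ φ y.1.1 t := by
    rintro s ⟨⟨p, L⟩, hp⟩
    obtain ⟨p', hp', hag, t, hst, ht⟩ := exists_agree_forall hh
      (fun r hr => dense r (hr.trans hp)) mono (fun r hr => ext r (hr.trans hp)) L s
    obtain ⟨L', hL', hspl⟩ := p'.exists_level_splits L
    exact ⟨⟨⟨p', L'⟩, hp'.trans hp⟩, hp', hL', hag, hspl, t, hst, loc p' t ht⟩
  choose next h_le h_lt h_agree h_split h_ext using step
  obtain ⟨enum, henum⟩ := exists_surjective_nat (List Bool)
  let x : ℕ → {x : PT h × ℕ // x.1 ≤ p₀} := fun n =>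
    Nat.rec ⟨(p₀, 0), le_rfl⟩ (fun n y => next (enum n) y) n
  obtain ⟨q, hq⟩ := exists_fusion hh (fun n => (x n).1.1) (fun n => (x n).1.2)
    (fun n => h_le _ (x n)) (fun n => h_lt _ (x n)) (fun n => h_agree _ (x n))
    (fun n => h_split _ (x n))
  refine ⟨{t | φ q t}, fun s => ?_, q, hq 0, fun t ht => ht⟩
  obtain ⟨n, rfl⟩ := henum s
  obtain ⟨t, hst, ht⟩ := h_ext (enum n) (x n)
  exact ⟨t, mono _ _ _ (hq (n + 1)) ht, hst⟩

end PT

end CohenPres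

theorem lemma3p2 (h : ℕ → ℕ) (hh : ∀ n, 1 < h n) :
    CohenPres.CohenPreserving.{u, 0} (CohenPres.PT h) := by
  intro p D H
  obtain ⟨E, hE, q, hq, hφ⟩ := CohenPres.PT.exists_denseSeqs hh (p₀ := p)
    (φ := fun r t => CohenPres.fMem (CohenPres.check (CohenPres.code t)) D r)
    (fun r hr s => CohenPres.exists_prefix_fMem (CohenPres.forces_fDenseOpen_mono hr H) s)
    (fun r r' t hr => CohenPres.fMem_mono hr)
    (fun r hr s t hst => CohenPres.fMem_of_prefix H hst hr)
    (fun r t => CohenPres.fMem_of_dense)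
  exact ⟨E, hE, q, hq, CohenPres.forces_codeSet_subset hφ⟩
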